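/- **Setting.** States are positive semidefinite matrices of unit trace on a finite-dimensional complex Hilbert space, and $T(\rho,\sigma)=\tfrac12\|\rho-\sigma\|_1$ with $\|B\|_1=\operatorname{Tr}\sqrt{B^\dagger B}$. For states $\rho,\sigma$ and $p,q\ge 0$ with $p+q=1$ let $$p_e(\rho,\sigma,p,q)=\min\{p\operatorname{Tr}[M_2\rho]+q\operatorname{Tr}[M_1\sigma] : M_1,M_2\ge 0,\ M_1+M_2=I\},$$ $$\mathrm{SC}_{(\rho,\sigma)}(\alpha,p,q)=\min\{n\in\mathbb N : p_e(\rho^{\otimes n},\sigma^{\otimes n},p,q)\le\alpha\}\in\mathbb N\cup\{\infty\}\qquad(\min\emptyset=\infty).$$ A quantum channel (completely positive trace-preserving linear map, with any finite-dimensional output space) $\mathcal A$ is $\varepsilon$-QLDP if $\operatorname{Tr}[M\mathcal A(\omega)]\le e^{\varepsilon}\operatorname{Tr}[M\mathcal A(\tau)]$ for all states $\omega,\tau$ and all $0\le M\le I$. The $\varepsilon$-QLDP sample complexity is $$\mathrm{SC}^{\varepsilon}_{(\rho,\sigma)}(\alpha,p,q)=\inf\{\mathrm{SC}_{(\mathcal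 A(\rho),\mathcal A(\sigma))}(\alpha,p,q) : \mathcal A \text{ is } \varepsilon\text{-QLDP}\}.$$ **Theorem (Bounds on Private Sample Complexity).** Let $p\in(0,1)$, $q=1-p$, let $\rho,\sigma$ be states on the same finite-dimensional Hilbert space, and let $\alpha\in(0,pq)$ and $\varepsilon>0$. Then $$\max\left\{\mathrm{SC}_{(\rho,\sigma)}(\alpha,p,q),\ \frac{C_{\varepsilon,p,q,\alpha}}{T(\rho,\sigma)}\right\}\ \le\ \mathrm{SC}^{\varepsilon}_{(\rho,\sigma)}(\alpha,p,q)\ \le\ \left\lceil 2\ln\!\left(\frac{\sqrt{pq}}{\alpha}\right)\left(\frac{e^\varepsilon+1}{(e^\varepsilon-1)\,T(\rho,\sigma)}\right)^{2}\right\rceil,$$ where $$C_{\varepsilon,p,q,\alpha}=\max\left\{\frac{\ln(pq/\alpha)\,(e^\varepsilon+1)}{\varepsilon\,(e^\varepsilon-1)},\ \frac{\bigl(pq-\alpha(1-\alpha)\bigr)(e^\varepsilon+1)}{2pq\,(e^{\varepsilon/2}-1)^2}\right\}.$$ If $\rho=\sigma$, both bounds are read as $\infty$ (a positive number divided by $0$),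 so that $\mathrm{SC}^{\varepsilon}_{(\rho,\sigma)}(\alpha,p,q)=\infty$. -/

import Mathlib

open scoped ENNReal

namespace QLDP

noncomputable section

open scoped ComplexOrder MatrixOrder

/-- A quantum state on `ℂ^d`: a positive semidefinite matrix of unit trace. -/
def IsState {d : Type*} [Fintype d] (ρ : Matrix d d ℂ) : Prop :=
  ρ.PosSemidef ∧ ρ.trace = 1

/-- A measurement operator: `0 ≤ M ≤ I`. -/
def IsEffect {d : Type*} [Fintype d] [DecidableEq d] (M : Matrix d d ℂ) : Prop :=
  M.PosSemidef ∧ (1 - M).PosSemidef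

/-- The trace norm `‖B‖₁ = Tr √(B† B)`. -/
def traceNorm {d : Type*} [Fintype d] [DecidableEq d] (B : Matrix d d ℂ) : ℝ :=
  (CFC.sqrt (B.conjTranspose * B)).trace.re

/-- The normalized trace distance `T(ρ, σ) = ‖ρ - σ‖₁ / 2`. -/
def traceDist {d : Type*} [Fintype d] [DecidableEq d] (ρ σ : Matrix d d ℂ) : ℝ :=
  (1 / 2) * traceNorm (ρ - σ)

/-- The map `id_k ⊗ Φ`, where a matrix over `Fin k × a` is viewed as a `k × k` matrix of
blocks indexed by `a`, and `Φ` is applied to each block. -/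
def ampliation {a b : Type*} (k : ℕ) (Φ : Matrix a a ℂ →ₗ[ℂ] Matrix b b ℂ)
    (X : Matrix (Fin k × a) (Fin k × a) ℂ) : Matrix (Fin k × b) (Fin k × b) ℂ :=
  Matrix.of fun i j => Φ (Matrix.of fun x y => X (i.1, x) (j.1, y)) i.2 j.2

/-- A quantum channel: a completely positive and trace-preserving linear map. -/
def IsChannel {a b : Type*} [Fintype a] [Fintype b]
    (Φ : Matrix a a ℂ →ₗ[ℂ] Matrix b b ℂ) : Prop :=
  (∀ (k : ℕ) (X : Matrix (Fin k × a) (Fin k × a) ℂ),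
    X.PosSemidef → (ampliation k Φ X).PosSemidef) ∧
  ∀ X : Matrix a a ℂ, (Φ X).trace = X.trace

/-- `Φ` is an `ε`-QLDP mechanism: a quantum channel such that
`Tr[M Φ(ρ)] ≤ e^ε Tr[M Φ(σ)]` for all states `ρ`, `σ` and all `0 ≤ M ≤ I`. -/
def IsQLDP {a b : Type*} [Fintype a] [Fintype b] [DecidableEq b] (ε : ℝ)
    (Φ : Matrix a a ℂ →ₗ[ℂ] Matrix b b ℂ) : Prop :=
  IsChannel Φ ∧
  ∀ ρ σ : Matrix a a ℂ, IsState ρ → IsState σ → ∀ M : Matrix b b ℂ, IsEffect M →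
    (M * Φ ρ).trace.re ≤ Real.exp ε * (M * Φ σ).trace.re

/-- The tensor power `ρ^{⊗ n}`, as a matrix indexed by `n`-tuples of basis indices. -/
def tensorPow {d : Type*} (n : ℕ) (ρ : Matrix d d ℂ) : Matrix (Fin n → d) (Fin n → d) ℂ :=
  Matrix.of fun i j => ∏ k, ρ (i k) (j k)

/-- The optimal error probability of symmetric hypothesis testing between `ρ` (prior `p`)
and `σ` (prior `q`): the optimum of `p Tr[M₂ ρ] + q Tr[M₁ σ]` over two-outcome POVMs. -/
def errorProb {d : Type*} [Fintype d] [DecidableEq d] (ρ σ : Matrix d d ℂ) (p q : ℝ) : ℝ :=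
  sInf {r : ℝ | ∃ M₁ M₂ : Matrix d d ℂ, M₁.PosSemidef ∧ M₂.PosSemidef ∧ M₁ + M₂ = 1 ∧
    r = p * (M₂ * ρ).trace.re + q * (M₁ * σ).trace.re}

/-- The sample complexity of symmetric hypothesis testing: the least `n` for which the optimal
error probability with `n` copies is at most `α` (and `⊤` if there is no such `n`). -/
def sampleComplexity {d : Type*} [Fintype d] [DecidableEq d] (ρ σ : Matrix d d ℂ)
    (α p q : ℝ) : ℕ∞ :=
  ⨅ (n : ℕ) (_ : errorProb (tensorPow n ρ) (tensorPow n σ) p q ≤ α), (n : ℕ∞)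

/-- The `ε`-QLDP sample complexity: the infimum over all `ε`-QLDP mechanisms `Φ`, with an
output system `ℂ^m` of any finite dimension `m`, of the sample complexity for `Φ ρ` and `Φ σ`. -/
def privateSampleComplexity {d : Type*} [Fintype d] [DecidableEq d] (ε : ℝ)
    (ρ σ : Matrix d d ℂ) (α p q : ℝ) : ℕ∞ :=
  ⨅ (m : ℕ) (Φ : Matrix d d ℂ →ₗ[ℂ] Matrix (Fin m) (Fin m) ℂ) (_ : IsQLDP ε Φ),
    sampleComplexity (Φ ρ) (Φ σ) α p q

/-- The constant `C_{ε,p,q,α}` of the lower bound. -/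
def lowerConst (ε p q α : ℝ) : ℝ :=
  max (Real.log (p * q / α) * (Real.exp ε + 1) / (ε * (Real.exp ε - 1)))
    ((p * q - α * (1 - α)) * (Real.exp ε + 1) / (2 * p * q * (Real.exp (ε / 2) - 1) ^ 2))

end

end QLDP

namespace QLDP

open scoped ComplexOrder MatrixOrder
open Matrix

/-! Lower bounds. Data processing gives the non-private one: the adjoint of `Φ^{⊗n}` turns a test of
the outputs into an equally good test of the inputs (`errorProb_le_of_isChannel`). For the other,
fix a private `Φ` and factor `Φ ρ = X X†`, `Φ σ = Y Y†`. By Cauchy–Schwarz, a test of `n` copies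
with error `e` obeys `p q |Tr X†Y|^{2n} ≤ e (1 - e)`. Measuring in the eigenbasis of the geometric
mean `M`, where `M Φ(σ) M = Φ ρ` (the Fuchs–Caves measurement), yields distributions `P`, `Q` whose
Bhattacharyya coefficient `B` is at most `|Tr X†Y|` for suitable `X`, `Y`. Privacy keeps `P/Q` and
`Q/P` below `e^ε`, and contracts the total variation to `V ≤ (e^ε - 1)/(e^ε + 1) · T`.

The problem is now classical. The estimates `B ≥ exp(-ε V / 2)` and `1 - B ≤ V (e^{ε/2} -
1)/(e^{ε/2} + 1)` bound `B^{2n}` from below in terms of `n V`, and give the two terms of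
`lowerConst`.

Upper bound. Apply randomized response to the projector on the positive part of `ρ - σ`. The two
outcome distributions differ by `δ = (e^ε - 1)/(e^ε + 1) · T`, so `B ≤ exp(-δ²/2)`, and the
likelihood-ratio test errs with probability at most `√(pq) B^n`. -/

/-! ### Functional calculus: Jordan decomposition and geometric mean -/

theorem re_trace_mul_nonneg {d : Type*} [Fintype d] [DecidableEq d] {A B : Matrix d d ℂ}
    (hA : A.PosSemidef) (hB : B.PosSemidef) : 0 ≤ (A * B).trace.re := by
  obtain ⟨C, rfl⟩ := CStarAlgebra.nonneg_iff_eq_star_mul_self.mp hB.nonneg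
  rw [star_eq_conjTranspose, ← Matrix.mul_assoc, Matrix.trace_mul_comm, ← Matrix.mul_assoc]
  exact (Complex.le_def.mp (hA.mul_mul_conjTranspose_same C).trace_nonneg).1

/-- Jordan decomposition of a Hermitian matrix, with the projector on its positive part. -/
theorem exists_jordan {d : Type*} [Fintype d] [DecidableEq d] {D : Matrix d d ℂ}
    (hD : D.IsHermitian) :
    ∃ A B E : Matrix d d ℂ, A.PosSemidef ∧ B.PosSemidef ∧ IsEffect E ∧ D = A - B ∧
      E * D = A ∧ A.trace.re + B.trace.re = traceNorm D := by
  have hsa : IsSelfAdjoint D := hD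
  -- The spectrum is finite, so even the indicator of the positive axis is admissible.
  have hc : ∀ f : ℝ → ℝ, ContinuousOn f (spectrum ℝ D) := fun f =>
    D.finite_real_spectrum.continuousOn f
  have hid : cfc (fun x : ℝ => x) D = D := cfc_id' ℝ D
  refine ⟨cfc (fun x : ℝ => max x 0) D, cfc (fun x : ℝ => max (-x) 0) D,
    cfc (fun x : ℝ => if 0 < x then 1 else 0) D, ?_, ?_, ⟨?_, ?_⟩, ?_, ?_, ?_⟩
  · exact (cfc_nonneg fun x _ => le_max_right _ _).posSemidef
  · exact (cfc_nonneg fun x _ => le_max_right _ _).posSemidef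
  · exact (cfc_nonneg fun x _ => by split_ifs <;> norm_num).posSemidef
  · rw [← Matrix.le_iff]
    exact cfc_le_one _ _ fun x _ => by split_ifs <;> norm_num
  · rw [← cfc_sub _ _ D (hc _) (hc _)]
    conv_lhs => rw [← hid]
    refine cfc_congr fun x _ => ?_
    rcases le_total 0 x with h | h <;> simp [h]
  · conv_lhs => enter [2]; rw [← hid]
    rw [← cfc_mul _ _ D (hc _) (hc _)]
    refine cfc_congr fun x _ => ?_
    split_ifs with h
    · simp [h.le]
    · simp [not_lt.mp h]
  · rw [← Complex.add_re, ← Matrix.trace_add, ← cfc_add _ _ _ (hc _) (hc _), traceNorm]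
    congr 2
    symm
    rw [CFC.sqrt_eq_iff _ _ (posSemidef_conjTranspose_mul_self D).nonneg
      (cfc_nonneg fun x _ => by positivity)]
    rw [← cfc_mul _ _ D (hc _) (hc _), hD.eq]
    conv_rhs => rw [← hid]
    rw [← cfc_mul _ _ D (hc _) (hc _)]
    refine cfc_congr fun x _ => ?_
    rcases le_total 0 x with h | h <;> simp [h]

/-- The geometric mean of `ρ` and the inverse of `σ`, for `ρ` supported in the support of `σ`. -/
theorem exists_posSemidef_mul_mul_eq {d : Type*} [Fintype d] [DecidableEq d]
    {ρ σ : Matrix d d ℂ} (hρ : ρ.PosSemidef) (hσ : σ.PosSemidef)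
    (h : ∀ E : Matrix d d ℂ, IsEffect E → E * σ = 0 → (E * ρ).trace.re ≤ 0) :
    ∃ M : Matrix d d ℂ, M.PosSemidef ∧ M * σ * M = ρ := by
  have hsa : IsSelfAdjoint σ := hσ.1
  have hc : ∀ f : ℝ → ℝ, ContinuousOn f (spectrum ℝ σ) := fun f =>
    σ.finite_real_spectrum.continuousOn f
  have hsp : ∀ x ∈ spectrum ℝ σ, 0 ≤ x := fun x hx => spectrum_nonneg_of_nonneg hσ.nonneg hx
  have hid : cfc (fun x : ℝ => x) σ = σ := cfc_id' ℝ σ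
  -- `Y = σ^{1/2}`, `S` is its pseudo-inverse (as `0⁻¹ = 0`), and `P` is the support projector. The
  -- witness will be `S √(YρY) S`.
  set Y := cfc (fun x : ℝ => √x) σ with hY
  set S := cfc (fun x : ℝ => (√x)⁻¹) σ with hS
  set P := cfc (fun x : ℝ => if 0 < x then 1 else 0) σ with hP
  have hYh : Yᴴ = Y := IsSelfAdjoint.star_eq (cfc_predicate _ σ)
  have hSh : Sᴴ = S := IsSelfAdjoint.star_eq (cfc_predicate _ σ)
  have hPh : Pᴴ = P := IsSelfAdjoint.star_eq (cfc_predicate _ σ)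
  have hYY : Y * Y = σ := by
    rw [hY, ← cfc_mul _ _ σ (hc _) (hc _)]
    conv_rhs => rw [← hid]
    exact cfc_congr fun x hx => Real.mul_self_sqrt (hsp x hx)
  have hSY : S * Y = P := by
    rw [hY, hS, hP, ← cfc_mul _ _ σ (hc _) (hc _)]
    refine cfc_congr fun x hx => ?_
    split_ifs with hx'
    · exact inv_mul_cancel₀ (Real.sqrt_pos.mpr hx').ne'
    · simp [Real.sqrt_eq_zero_of_nonpos (not_lt.mp hx')]
  have hYS : Y * S = P := by
    rw [← hSY, hY, hS]; exact cfc_commute_cfc _ _ _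
  have hYP : Y * P = Y := by
    rw [hY, hP, ← cfc_mul _ _ σ (hc _) (hc _)]
    refine cfc_congr fun x hx => ?_
    split_ifs with hx'
    · simp
    · simp [Real.sqrt_eq_zero_of_nonpos (not_lt.mp hx')]
  have hP0 : (1 - P).PosSemidef := by
    rw [← Matrix.le_iff]
    exact cfc_le_one _ _ fun x _ => by split_ifs <;> norm_num
  have hPP : P * P = P := by
    rw [hP, ← cfc_mul _ _ σ (hc _) (hc _)]
    refine cfc_congr fun x hx => ?_
    split_ifs <;> simp
  have hPpos : P.PosSemidef :=
    (cfc_nonneg fun x _ => by split_ifs <;> norm_num).posSemidef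
  have hPY : P * Y = Y := by
    have := congrArg conjTranspose hYP
    rwa [conjTranspose_mul, hYh, hPh] at this
  have hcomp : ∀ A : Matrix d d ℂ, A.PosSemidef → ((1 - P) * A).trace.re ≤ 0 → A * P = A := by
    intro A hA hA0
    obtain ⟨C, rfl⟩ := CStarAlgebra.nonneg_iff_eq_star_mul_self.mp hA.nonneg
    rw [star_eq_conjTranspose] at *
    have hPP' : (1 - P) * (1 - P) = 1 - P := by
      rw [Matrix.sub_mul, Matrix.mul_sub, Matrix.mul_sub, hPP]; simp
    have hz : C * (1 - P) = 0 := by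
      rw [← trace_conjTranspose_mul_self_eq_zero_iff]
      have e : ((C * (1 - P))ᴴ * (C * (1 - P))).trace = ((1 - P) * (Cᴴ * C)).trace := by
        rw [conjTranspose_mul, conjTranspose_sub, conjTranspose_one, hPh, Matrix.mul_assoc,
          Matrix.trace_mul_comm]
        simp only [Matrix.mul_assoc]
        rw [hPP', Matrix.trace_mul_comm (1 - P), Matrix.mul_assoc]
      have h0 : 0 ≤ ((C * (1 - P))ᴴ * (C * (1 - P))).trace :=
        (posSemidef_conjTranspose_mul_self _).trace_nonneg
      rw [← e] at hA0
      refine le_antisymm ?_ h0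
      rw [Complex.le_def] at h0 ⊢
      exact ⟨hA0, h0.2.symm⟩
    have : C * P = C := by
      rw [Matrix.mul_sub, Matrix.mul_one, sub_eq_zero] at hz
      exact hz.symm
    rw [Matrix.mul_assoc, this]
  -- The effect `1 - P` annihilates `σ`, so the hypothesis makes it annihilate `ρ` too.
  have hρP : ρ * P = ρ := hcomp ρ hρ (h _ ⟨hP0, by simpa using hPpos⟩ (by
    rw [← hYY, ← Matrix.mul_assoc, Matrix.sub_mul, hPY]; simp))
  have hPρ : P * ρ = ρ := by
    have := congrArg conjTranspose hρP
    rwa [conjTranspose_mul, hρ.1.eq, hPh] at this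
  have hW : (Y * ρ * Y).PosSemidef := by
    simpa [hYh] using hρ.mul_mul_conjTranspose_same Y
  set R := CFC.sqrt (Y * ρ * Y) with hR
  have hRpos : R.PosSemidef := (CFC.sqrt_nonneg _).posSemidef
  have hRR : R * R = Y * ρ * Y := CFC.sqrt_mul_sqrt_self _ hW.nonneg
  have hRP : R * P = R := by
    have hRh : Rᴴ = R := hRpos.1
    have hz : R * (1 - P) = 0 := by
      rw [← conjTranspose_mul_self_eq_zero, conjTranspose_mul, Matrix.mul_assoc,
        ← Matrix.mul_assoc Rᴴ, hRh, hRR, Matrix.mul_assoc _ Y, Matrix.mul_sub Y, hYP]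
      simp
    rw [Matrix.mul_sub, Matrix.mul_one, sub_eq_zero] at hz
    exact hz.symm
  refine ⟨S * R * S, by simpa [hSh] using hRpos.mul_mul_conjTranspose_same S, ?_⟩
  calc S * R * S * σ * (S * R * S) = S * R * (S * Y) * (Y * S) * R * S := by
        rw [← hYY]; simp only [Matrix.mul_assoc]
    _ = S * (R * R) * S := by
        rw [hSY, hYS]; simp only [Matrix.mul_assoc]
        rw [← Matrix.mul_assoc P P, hPP, ← Matrix.mul_assoc R P, hRP]
    _ = (S * Y) * ρ * (Y * S) := by rw [hRR]; simp only [Matrix.mul_assoc]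
    _ = ρ := by rw [hSY, hYS, hPρ, hρP]

/-! ### Classical inequalities for distributions with bounded likelihood ratio -/

/-- Pointwise, with `x = √P` and `y = √Q`, one has `(x - y)² = |x² - y²| · |x - y| / (x + y)` when
`x + y > 0`. The last factor is at most `(s - 1)/(s + 1)` for `s = e^{ε/2}`, because `x/y` lies in
`[1/s, s]`. -/
theorem one_sub_sum_sqrt_le {ι : Type*} [Fintype ι] {P Q : ι → ℝ} {ε : ℝ}
    (hP : ∀ i, 0 ≤ P i) (hQ : ∀ i, 0 ≤ Q i) (hP1 : ∑ i, P i = 1) (hQ1 : ∑ i, Q i = 1)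
    (hPQ : ∀ i, P i ≤ Real.exp ε * Q i) (hQP : ∀ i, Q i ≤ Real.exp ε * P i) :
    (1 - ∑ i, √(P i * Q i)) * (Real.exp (ε / 2) + 1) ≤
      ((∑ i, |P i - Q i|) / 2) * (Real.exp (ε / 2) - 1) := by
  set s := Real.exp (ε / 2) with hs
  have hs0 : 0 < s := Real.exp_pos _
  have hss : Real.exp ε = s ^ 2 := by rw [hs, ← Real.exp_nat_mul]; congr 1; push_cast; ring
  have key : ∀ x y : ℝ, 0 ≤ x → 0 ≤ y → x ≤ s * y → y ≤ s * x →
      (x - y) ^ 2 * (s + 1) ≤ |x ^ 2 - y ^ 2| * (s - 1) := by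
    intro x y hx hy h1 h2
    rcases le_total y x with h | h
    · rw [abs_of_nonneg (by nlinarith)]
      nlinarith [mul_nonneg (sub_nonneg.mpr h) (sub_nonneg.mpr h1)]
    · rw [abs_of_nonpos (by nlinarith)]
      nlinarith [mul_nonneg (sub_nonneg.mpr h) (sub_nonneg.mpr h2)]
  have hpt : ∀ i, (P i + Q i - 2 * √(P i * Q i)) * (s + 1) ≤ |P i - Q i| * (s - 1) := by
    intro i
    have aux : ∀ x y : ℝ, x ≤ s ^ 2 * y → √x ≤ s * √y := by
      intro x y h
      calc √x ≤ √(s ^ 2 * y) := Real.sqrt_le_sqrt h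
        _ = s * √y := by rw [Real.sqrt_mul (sq_nonneg s), Real.sqrt_sq hs0.le]
    have := key (√(P i)) (√(Q i)) (Real.sqrt_nonneg _) (Real.sqrt_nonneg _)
      (aux _ _ (hss ▸ hPQ i)) (aux _ _ (hss ▸ hQP i))
    rw [Real.sq_sqrt (hP i), Real.sq_sqrt (hQ i), sub_sq, Real.sq_sqrt (hP i),
      Real.sq_sqrt (hQ i)] at this
    rw [Real.sqrt_mul (hP i)]
    linarith
  have hsum := Finset.sum_le_sum fun i (_ : i ∈ Finset.univ) => hpt i
  rw [← Finset.sum_mul, ← Finset.sum_mul, Finset.sum_sub_distrib, Finset.sum_add_distrib,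
    hP1, hQ1, ← Finset.mul_sum] at hsum
  linarith

/-- The convex function `r log r` at `r = x/y` lies below its chords over `[e^{-ε}, 1]` and `[1,
e^ε]`. The two brackets on the right are the positive and negative parts of `x - y`; each sums to
`V` over the outcomes, so that summation gives `D(P‖Q) ≤ ε V`. -/
theorem mul_log_div_le {x y ε : ℝ} (hx : 0 < x) (hy : 0 < y) (hε : 0 < ε)
    (hxy : x ≤ Real.exp ε * y) (hyx : y ≤ Real.exp ε * x) :
    (Real.exp ε - 1) * (x * Real.log (x / y)) ≤
      ε * (Real.exp ε * ((|x - y| + (x - y)) / 2) - (|x - y| - (x - y)) / 2) := by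
  set E := Real.exp ε with hE
  have hE1 : 1 < E := Real.one_lt_exp_iff.mpr hε
  have chord : ∀ a b r : ℝ, 0 < a → a < b → a ≤ r → r ≤ b →
      (b - a) * (r * Real.log r) ≤ (b - r) * (a * Real.log a) + (r - a) * (b * Real.log b) := by
    intro a b r ha hab har hrb
    have hba : 0 < b - a := sub_pos.mpr hab
    have := Real.convexOn_mul_log.2 (Set.mem_Ici.mpr ha.le) (Set.mem_Ici.mpr (ha.trans hab).le)
      (div_nonneg (sub_nonneg.mpr hrb) hba.le) (div_nonneg (sub_nonneg.mpr har) hba.le)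
      (by field_simp; ring)
    simp only [smul_eq_mul] at this
    have e : (b - r) / (b - a) * a + (r - a) / (b - a) * b = r := by field_simp; ring
    rw [e] at this
    calc (b - a) * (r * Real.log r) ≤ (b - a) * ((b - r) / (b - a) * (a * Real.log a) +
          (r - a) / (b - a) * (b * Real.log b)) := by gcongr
      _ = _ := by field_simp
  obtain ⟨r, rfl⟩ : ∃ r, x = r * y := ⟨x / y, by field_simp⟩
  have hr : 0 < r := pos_of_mul_pos_left hx hy.le
  have hry : r * y / y = r := by field_simp
  rw [hry]
  have hrE : r ≤ E := le_of_mul_le_mul_right hxy hy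
  have hrE' : 1 ≤ E * r := le_of_mul_le_mul_right (by linarith) hy
  rcases le_total 1 r with h | h
  · rw [abs_of_nonneg (by nlinarith)]
    have := chord 1 E r one_pos hE1 h hrE
    rw [Real.log_one, hE, Real.log_exp, ← hE] at this
    nlinarith [mul_le_mul_of_nonneg_right this hy.le]
  · rw [abs_of_nonpos (by nlinarith)]
    have := chord E⁻¹ 1 r (by positivity) (inv_lt_one_of_one_lt₀ hE1)
      (by rw [inv_le_iff_one_le_mul₀' (by positivity)]; exact hrE') h
    rw [Real.log_one, Real.log_inv, hE, Real.log_exp, ← hE] at this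
    have h2 := mul_le_mul_of_nonneg_left this (a := E * y) (by positivity)
    have e1 : E * y * ((1 - E⁻¹) * (r * Real.log r)) =
      (E - 1) * (r * y * Real.log r) := by field_simp
    have e2 : E * y * ((1 - r) * (E⁻¹ * -ε) + (r - E⁻¹) * (1 * 0)) = - ε * (1 - r) * y := by
      field_simp
      ring
    rw [e1, e2] at h2
    nlinarith

/-- The sum is the `P`-mean of `exp(-½ log(P/Q))`, hence at least `exp(-D(P‖Q)/2)` by Jensen, and
`D(P‖Q) ≤ ε V`. -/
theorem exp_neg_le_sum_sqrt {ι : Type*} [Fintype ι] {P Q : ι → ℝ} {ε : ℝ} (hε : 0 < ε)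
    (hP : ∀ i, 0 ≤ P i) (hQ : ∀ i, 0 ≤ Q i) (hP1 : ∑ i, P i = 1) (hQ1 : ∑ i, Q i = 1)
    (hPQ : ∀ i, P i ≤ Real.exp ε * Q i) (hQP : ∀ i, Q i ≤ Real.exp ε * P i) :
    Real.exp (-(ε * ((∑ i, |P i - Q i|) / 2) / 2)) ≤ ∑ i, √(P i * Q i) := by
  have hE1 : 1 < Real.exp ε := Real.one_lt_exp_iff.mpr hε
  have hJ := convexOn_exp.map_sum_le (t := Finset.univ) (w := P)
    (p := fun i => -(Real.log (P i / Q i) / 2)) (fun i _ => hP i) hP1 (fun _ _ => Set.mem_univ _)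
  have hterm : ∀ i, P i • Real.exp (-(Real.log (P i / Q i) / 2)) = √(P i * Q i) := by
    intro i
    rcases (hP i).eq_or_lt with h | h
    · simp [← h]
    have hq : 0 < Q i := pos_of_mul_pos_right (h.trans_le (hPQ i)) (Real.exp_pos _).le
    have e : -(Real.log (P i / Q i) / 2) = Real.log (Q i / P i) * (1 / 2) := by
      rw [← inv_div (P i), Real.log_inv]; ring
    rw [e, Real.exp_mul, Real.exp_log (by positivity), ← Real.sqrt_eq_rpow, smul_eq_mul]
    nth_rw 1 [← Real.sqrt_sq h.le]
    rw [← Real.sqrt_mul (by positivity)]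
    congr 1
    field_simp
  rw [Finset.sum_congr rfl fun i _ => hterm i] at hJ
  refine le_trans (Real.exp_le_exp.mpr ?_) hJ
  have hpt : ∀ i, (Real.exp ε - 1) * (P i * Real.log (P i / Q i)) ≤
      ε * (Real.exp ε * ((|P i - Q i| + (P i - Q i)) / 2) - (|P i - Q i| - (P i - Q i)) / 2) := by
    intro i
    rcases (hP i).eq_or_lt with h | h
    · have hq : Q i = 0 := le_antisymm (by simpa [← h] using hQP i) (hQ i)
      simp [← h, hq]
    have hq : 0 < Q i := pos_of_mul_pos_right (h.trans_le (hPQ i)) (Real.exp_pos _).le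
    exact mul_log_div_le h hq hε (hPQ i) (hQP i)
  have hsum := Finset.sum_le_sum fun i (_ : i ∈ Finset.univ) => hpt i
  rw [← Finset.mul_sum, ← Finset.mul_sum, Finset.sum_sub_distrib, ← Finset.mul_sum,
    ← Finset.sum_div, ← Finset.sum_div, Finset.sum_add_distrib, Finset.sum_sub_distrib,
    Finset.sum_sub_distrib, Finset.sum_sub_distrib, hP1, hQ1, sub_self, add_zero,
    sub_zero] at hsum
  have h3 : ∑ i, P i * Real.log (P i / Q i) ≤ ε * ((∑ i, |P i - Q i|) / 2) := by
    refine le_of_mul_le_mul_left ?_ (sub_pos.mpr hE1)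
    linarith
  have h4 : ∑ i, P i • -(Real.log (P i / Q i) / 2) =
      -((∑ i, P i * Real.log (P i / Q i)) / 2) := by
    rw [Finset.sum_div, ← Finset.sum_neg_distrib]
    refine Finset.sum_congr rfl fun i _ => ?_
    rw [smul_eq_mul]; ring
  rw [h4]
  linarith

/-! ### Overlaps, error probabilities and tensor powers -/

/-- Cauchy–Schwarz for the semi-inner product `Tr[X† M Y]`. -/
theorem norm_trace_mul_mul_le {a b : Type*} [Fintype a] [Fintype b] [DecidableEq a]
    (X Y : Matrix a b ℂ) {M : Matrix a a ℂ} (hM : M.PosSemidef) :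
    ‖(Xᴴ * M * Y).trace‖ ≤
      √((M * (X * Xᴴ)).trace.re) * √((M * (Y * Yᴴ)).trace.re) := by
  obtain ⟨C, rfl⟩ := CStarAlgebra.nonneg_iff_eq_star_mul_self.mp hM.nonneg
  rw [star_eq_conjTranspose]
  have e : ∀ Z W : Matrix a b ℂ, (Zᴴ * (Cᴴ * C) * W).trace =
      ∑ x : b × a, star ((C * Z) x.2 x.1) * (C * W) x.2 x.1 := by
    intro Z W
    rw [← Matrix.mul_assoc, ← conjTranspose_mul, Matrix.mul_assoc, Fintype.sum_prod_type]
    simp only [Matrix.trace, Matrix.diag_apply, Matrix.mul_apply (M := (C * Z)ᴴ),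
      conjTranspose_apply]
  have e2 : ∀ Z : Matrix a b ℂ, (Cᴴ * C * (Z * Zᴴ)).trace.re =
      ∑ x : b × a, ‖(C * Z) x.2 x.1‖ ^ 2 := by
    intro Z
    rw [← Matrix.mul_assoc, Matrix.trace_mul_comm, ← Matrix.mul_assoc, e, Complex.re_sum]
    refine Finset.sum_congr rfl fun x _ => ?_
    rw [Complex.star_def, ← Complex.normSq_eq_conj_mul_self, Complex.ofReal_re,
      Complex.normSq_eq_norm_sq]
  rw [e, e2, e2]
  calc _ ≤ ∑ x : b × a, ‖star ((C * X) x.2 x.1) * (C * Y) x.2 x.1‖ := norm_sum_le _ _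
    _ = ∑ x : b × a, ‖(C * X) x.2 x.1‖ * ‖(C * Y) x.2 x.1‖ := by simp
    _ ≤ _ := Real.sum_mul_le_sqrt_mul_sqrt _ _ _

/-- The error probability `e` of any test obeys `p q F ≤ e (1 - e)`. -/
theorem mul_norm_trace_sq_le {a b : Type*} [Fintype a] [Fintype b] [DecidableEq a]
    {X Y : Matrix a b ℂ} (hX : (X * Xᴴ).trace = 1) (hY : (Y * Yᴴ).trace = 1)
    {M₁ M₂ : Matrix a a ℂ} (h₁ : M₁.PosSemidef) (h₂ : M₂.PosSemidef) (hM : M₁ + M₂ = 1)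
    {p q e : ℝ} (hp : 0 ≤ p) (hq : 0 ≤ q) (hpq : p + q = 1)
    (he : e = p * (M₂ * (X * Xᴴ)).trace.re + q * (M₁ * (Y * Yᴴ)).trace.re) :
    p * q * ‖(Xᴴ * Y).trace‖ ^ 2 ≤ e * (1 - e) := by
  have hsum : ∀ Z : Matrix a b ℂ, (Z * Zᴴ).trace = 1 →
      (M₁ * (Z * Zᴴ)).trace.re = 1 - (M₂ * (Z * Zᴴ)).trace.re := by
    intro Z hZ
    rw [eq_sub_iff_add_eq, ← Complex.add_re, ← Matrix.trace_add, ← Matrix.add_mul, hM,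
      Matrix.one_mul, hZ, Complex.one_re]
  have hpos : ∀ (Z : Matrix a b ℂ) {M : Matrix a a ℂ}, M.PosSemidef →
      0 ≤ (M * (Z * Zᴴ)).trace.re := fun Z M hM =>
    re_trace_mul_nonneg hM (posSemidef_self_mul_conjTranspose Z)
  have hle : ‖(Xᴴ * Y).trace‖ ≤
      √((M₁ * (X * Xᴴ)).trace.re) * √((M₁ * (Y * Yᴴ)).trace.re) +
      √((M₂ * (X * Xᴴ)).trace.re) * √((M₂ * (Y * Yᴴ)).trace.re) := by
    calc ‖(Xᴴ * Y).trace‖ = ‖(Xᴴ * M₁ * Y).trace + (Xᴴ * M₂ * Y).trace‖ := by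
          rw [← Matrix.trace_add, ← Matrix.add_mul, ← Matrix.mul_add, hM, Matrix.mul_one]
      _ ≤ _ := (norm_add_le _ _).trans (add_le_add (norm_trace_mul_mul_le X Y h₁)
          (norm_trace_mul_mul_le X Y h₂))
  have s1 := Real.sq_sqrt (hpos X h₁)
  have s2 := Real.sq_sqrt (hpos X h₂)
  have s3 := Real.sq_sqrt (hpos Y h₁)
  have s4 := Real.sq_sqrt (hpos Y h₂)
  have hx := hsum X hX
  have hy := hsum Y hY
  set x₁ := √((M₁ * (X * Xᴴ)).trace.re)
  set x₂ := √((M₂ * (X * Xᴴ)).trace.re)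
  set y₁ := √((M₁ * (Y * Yᴴ)).trace.re)
  set y₂ := √((M₂ * (Y * Yᴴ)).trace.re)
  have e1 : e = p * x₂ ^ 2 + q * y₁ ^ 2 := by rw [s2, s3, he]
  have e2 : 1 - e = p * x₁ ^ 2 + q * y₂ ^ 2 := by
    rw [s1, s4, he, hx]; linear_combination -q * hy - hpq
  calc p * q * ‖(Xᴴ * Y).trace‖ ^ 2 ≤ p * q * (x₁ * y₁ + x₂ * y₂) ^ 2 := by gcongr
    _ ≤ e * (1 - e) := by
      rw [e2, e1]
      -- The difference of the two sides is exactly this square.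
      nlinarith [sq_nonneg (p * x₂ * x₁ - q * y₁ * y₂)]

/-- The tensor product of a family of matrices, indexed by tuples. -/
def tensorFam {n : ℕ} {a b : Type*} (A : Fin n → Matrix a b ℂ) :
    Matrix (Fin n → a) (Fin n → b) ℂ :=
  Matrix.of fun i j => ∏ k, A k (i k) (j k)

theorem tensorPow_eq_tensorFam {a : Type*} (n : ℕ) (ρ : Matrix a a ℂ) :
    tensorPow n ρ = tensorFam fun _ : Fin n => ρ := rfl

theorem tensorFam_mul {n : ℕ} {a b c : Type*} [Fintype b] (A : Fin n → Matrix a b ℂ)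
    (B : Fin n → Matrix b c ℂ) :
    (tensorFam fun k => A k * B k) = tensorFam A * tensorFam B := by
  classical
  ext i j
  simp only [tensorFam, Matrix.of_apply, Matrix.mul_apply, Finset.prod_univ_sum,
    Fintype.piFinset_univ, Finset.prod_mul_distrib]

/-- Expanding a tensor power of a sum mixes the summands, so tensor products of non-constant
families are needed: they are the Kraus operators of `Φ^{⊗n}`. -/
theorem tensorFam_sum {n : ℕ} {a b ι : Type*} [Fintype ι] (A : ι → Matrix a b ℂ) :
    (tensorFam fun _ : Fin n => ∑ s, A s) =
      ∑ f : Fin n → ι, tensorFam fun k => A (f k) := by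
  classical
  ext i j
  simp only [tensorFam, Matrix.of_apply, Matrix.sum_apply, Finset.prod_univ_sum,
    Fintype.piFinset_univ]

theorem tensorFam_conjTranspose {n : ℕ} {a b : Type*} (A : Fin n → Matrix a b ℂ) :
    (tensorFam fun k => (A k)ᴴ) = (tensorFam A)ᴴ := by
  ext i j
  simp [tensorFam, Matrix.conjTranspose_apply]

theorem tensorFam_one {n : ℕ} {a : Type*} [DecidableEq a] :
    (tensorFam fun _ : Fin n => (1 : Matrix a a ℂ)) = 1 := by
  ext i j
  simp only [tensorFam, Matrix.of_apply, Matrix.one_apply, Finset.prod_ite_zero,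
    Finset.prod_const_one, Finset.mem_univ, true_imp_iff, funext_iff]

theorem trace_tensorFam {n : ℕ} {a : Type*} [Fintype a] (A : Fin n → Matrix a a ℂ) :
    (tensorFam A).trace = ∏ k, (A k).trace := by
  classical
  simp only [tensorFam, Matrix.trace, Matrix.diag_apply, Matrix.of_apply, Finset.prod_univ_sum,
    Fintype.piFinset_univ]

theorem tensorPow_posSemidef {a : Type*} [Fintype a] [DecidableEq a] {ρ : Matrix a a ℂ}
    (hρ : ρ.PosSemidef) (n : ℕ) : (tensorPow n ρ).PosSemidef := by
  obtain ⟨C, rfl⟩ := CStarAlgebra.nonneg_iff_eq_star_mul_self.mp hρ.nonneg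
  rw [star_eq_conjTranspose, tensorPow_eq_tensorFam, tensorFam_mul, tensorFam_conjTranspose]
  exact posSemidef_conjTranspose_mul_self _

theorem errorProb_bddBelow {d : Type*} [Fintype d] [DecidableEq d] {ρ σ : Matrix d d ℂ}
    (hρ : ρ.PosSemidef) (hσ : σ.PosSemidef) {p q : ℝ} (hp : 0 ≤ p) (hq : 0 ≤ q) :
    BddBelow {r : ℝ | ∃ M₁ M₂ : Matrix d d ℂ, M₁.PosSemidef ∧ M₂.PosSemidef ∧ M₁ + M₂ = 1 ∧
      r = p * (M₂ * ρ).trace.re + q * (M₁ * σ).trace.re} := by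
  refine ⟨0, ?_⟩
  rintro r ⟨M₁, M₂, h₁, h₂, -, rfl⟩
  have := re_trace_mul_nonneg h₂ hρ
  have := re_trace_mul_nonneg h₁ hσ
  positivity

theorem errorProb_nonempty {d : Type*} [Fintype d] [DecidableEq d] (ρ σ : Matrix d d ℂ)
    (p q : ℝ) :
    {r : ℝ | ∃ M₁ M₂ : Matrix d d ℂ, M₁.PosSemidef ∧ M₂.PosSemidef ∧ M₁ + M₂ = 1 ∧
      r = p * (M₂ * ρ).trace.re + q * (M₁ * σ).trace.re}.Nonempty :=
  ⟨_, 1, 0, PosSemidef.one, PosSemidef.zero, add_zero _, rfl⟩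

theorem mul_norm_trace_pow_le {a b : Type*} [Fintype a] [Fintype b] [DecidableEq a]
    {X Y : Matrix a b ℂ} (hX : (X * Xᴴ).trace = 1) (hY : (Y * Yᴴ).trace = 1)
    {p q α : ℝ} (hp : 0 ≤ p) (hq : 0 ≤ q) (hpq : p + q = 1) (hα0 : 0 ≤ α) (hα : α ≤ 1 / 2)
    {n : ℕ} (h : errorProb (tensorPow n (X * Xᴴ)) (tensorPow n (Y * Yᴴ)) p q ≤ α) :
    p * q * (‖(Xᴴ * Y).trace‖ ^ n) ^ 2 ≤ α * (1 - α) := by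
  have hten : ∀ Z : Matrix a b ℂ, tensorPow n (Z * Zᴴ) =
      (tensorFam fun _ : Fin n => Z) * (tensorFam fun _ : Fin n => Z)ᴴ := fun Z => by
    rw [← tensorFam_conjTranspose, ← tensorFam_mul, tensorPow_eq_tensorFam]
  have htr : ∀ Z : Matrix a b ℂ, (Z * Zᴴ).trace = 1 →
      ((tensorFam fun _ : Fin n => Z) * (tensorFam fun _ : Fin n => Z)ᴴ).trace = 1 := by
    intro Z hZ
    rw [← hten, tensorPow_eq_tensorFam, trace_tensorFam]
    simp [hZ]
  have hXY : ‖((tensorFam fun _ : Fin n => X)ᴴ * (tensorFam fun _ : Fin n => Y)).trace‖ =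
      ‖(Xᴴ * Y).trace‖ ^ n := by
    rw [← tensorFam_conjTranspose, ← tensorFam_mul, trace_tensorFam]
    simp
  -- A near-optimal test suffices: `t (1 - t)` is increasing up to `1/2`, and exceeding `α` by less
  -- than `δ` raises it by at most `δ`.
  refine le_of_forall_pos_le_add fun δ hδ => ?_
  obtain ⟨e, ⟨M₁, M₂, h₁, h₂, h12, he⟩, heα⟩ :=
    exists_lt_of_csInf_lt (errorProb_nonempty _ _ p q) (h.trans_lt (lt_add_of_pos_right α hδ))
  rw [hten, hten] at he
  have := mul_norm_trace_sq_le (htr X hX) (htr Y hY) h₁ h₂ h12 hp hq hpq he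
  rw [hXY] at this
  refine this.trans ?_
  rcases le_total e α with hle | hle
  · nlinarith
  · nlinarith

/-! ### Kraus representation and data processing -/

/-- Choi's theorem: a completely positive map has a Kraus representation. -/
theorem exists_kraus {a b : Type*} [Fintype a] [DecidableEq a] [Fintype b] [DecidableEq b]
    {Φ : Matrix a a ℂ →ₗ[ℂ] Matrix b b ℂ}
    (hΦ : ∀ (k : ℕ) (X : Matrix (Fin k × a) (Fin k × a) ℂ),
      X.PosSemidef → (ampliation k Φ X).PosSemidef) :
    ∃ K : Fin (Fintype.card a) × b → Matrix b a ℂ, ∀ X, Φ X = ∑ i, K i * X * (K i)ᴴ := by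
  set e := Fintype.equivFin a
  -- The unnormalized maximally entangled vector. Its image under `id ⊗ Φ` is the Choi matrix `G†
  -- G`, and the conjugated rows of `G`, reshaped, are the Kraus operators.
  set v : Fin (Fintype.card a) × a → ℂ := fun x => if e x.2 = x.1 then 1 else 0 with hv
  obtain ⟨G, hG⟩ := CStarAlgebra.nonneg_iff_eq_star_mul_self.mp
    (hΦ _ _ (posSemidef_vecMulVec_self_star v)).nonneg
  refine ⟨fun g => Matrix.of fun x s => star (G g (e s, x)), fun X => ?_⟩
  have hent : ∀ (s t : a) (x y : b), Φ (Matrix.single s t 1) x y =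
      ∑ g, star (G g (e s, x)) * G g (e t, y) := by
    intro s t x y
    have h1 := congrFun (congrFun hG (e s, x)) (e t, y)
    rw [star_eq_conjTranspose, Matrix.mul_apply] at h1
    simp only [conjTranspose_apply] at h1
    rw [← h1, ampliation, Matrix.of_apply]
    refine congrFun (congrFun (congrArg Φ (Matrix.ext fun u w => ?_)) x) y
    simp only [vecMulVec_apply, hv, Matrix.single_apply, Matrix.of_apply, Pi.star_apply,
      EmbeddingLike.apply_eq_iff_eq, eq_comm (a := u), eq_comm (a := w)]
    by_cases h1 : s = u <;> by_cases h2 : t = w <;> simp [h1, h2]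
  ext x y
  conv_lhs => rw [matrix_eq_sum_single X]
  simp only [map_sum, Matrix.sum_apply]
  have hs : ∀ s t, Φ (Matrix.single s t (X s t)) x y =
      ∑ g, star (G g (e s, x)) * X s t * G g (e t, y) := by
    intro s t
    have : Matrix.single s t (X s t) = X s t • Matrix.single s t (1 : ℂ) := by simp
    rw [this, map_smul, Matrix.smul_apply, hent, smul_eq_mul, Finset.mul_sum]
    exact Finset.sum_congr rfl fun g _ => by ring
  simp only [hs, Matrix.mul_apply, conjTranspose_apply, Matrix.of_apply, star_star,
    Finset.sum_mul]
  rw [Finset.sum_comm' (t' := Finset.univ) (s' := fun _ => Finset.univ) (by simp)]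
  rw [Finset.sum_congr rfl fun t _ => Finset.sum_comm]
  rw [Finset.sum_comm]

/-- Data processing: channels do not decrease the error probability for `n` copies. -/
theorem errorProb_le_of_isChannel {a b : Type*} [Fintype a] [DecidableEq a] [Fintype b]
    [DecidableEq b] {Φ : Matrix a a ℂ →ₗ[ℂ] Matrix b b ℂ} (hΦ : IsChannel Φ)
    {ρ σ : Matrix a a ℂ} (hρ : ρ.PosSemidef) (hσ : σ.PosSemidef) {p q : ℝ} (hp : 0 ≤ p)
    (hq : 0 ≤ q) (n : ℕ) :
    errorProb (tensorPow n ρ) (tensorPow n σ) p q ≤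
      errorProb (tensorPow n (Φ ρ)) (tensorPow n (Φ σ)) p q := by
  obtain ⟨K, hK⟩ := exists_kraus hΦ.1
  have hKK : ∑ i, (K i)ᴴ * K i = 1 := by
    rw [Matrix.ext_iff_trace_mul_right]
    intro X
    rw [Matrix.one_mul, ← hΦ.2 X, hK X, Matrix.sum_mul, Matrix.trace_sum, Matrix.trace_sum]
    refine Finset.sum_congr rfl fun i _ => ?_
    rw [Matrix.trace_mul_comm (K i * X), Matrix.mul_assoc]
  set T : (Fin n → Fin (Fintype.card a) × b) → Matrix (Fin n → b) (Fin n → a) ℂ :=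
    fun f => tensorFam fun k => K (f k) with hT
  have hTT : ∑ f, (T f)ᴴ * T f = 1 := by
    rw [← tensorFam_one (n := n), ← hKK, tensorFam_sum]
    refine Finset.sum_congr rfl fun f _ => ?_
    rw [tensorFam_mul, tensorFam_conjTranspose]
  have hpow : ∀ X, tensorPow n (Φ X) = ∑ f, T f * tensorPow n X * (T f)ᴴ := by
    intro X
    rw [tensorPow_eq_tensorFam, hK, tensorFam_sum]
    refine Finset.sum_congr rfl fun f _ => ?_
    rw [tensorFam_mul, tensorFam_conjTranspose, tensorFam_mul, tensorPow_eq_tensorFam]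
  have htr : ∀ M X, (M * tensorPow n (Φ X)).trace =
      ((∑ f, (T f)ᴴ * M * T f) * tensorPow n X).trace := by
    intro M X
    rw [hpow, Matrix.mul_sum, Matrix.sum_mul, Matrix.trace_sum, Matrix.trace_sum]
    refine Finset.sum_congr rfl fun f _ => ?_
    rw [← Matrix.mul_assoc, Matrix.trace_mul_comm]
    simp only [Matrix.mul_assoc]
  refine csInf_le_csInf (errorProb_bddBelow (tensorPow_posSemidef hρ n)
    (tensorPow_posSemidef hσ n) hp hq) (errorProb_nonempty _ _ p q) ?_
  rintro r ⟨M₁, M₂, h₁, h₂, h12, rfl⟩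
  refine ⟨∑ f, (T f)ᴴ * M₁ * T f, ∑ f, (T f)ᴴ * M₂ * T f,
    posSemidef_sum _ fun f _ => h₁.conjTranspose_mul_mul_same _,
    posSemidef_sum _ fun f _ => h₂.conjTranspose_mul_mul_same _, ?_, by rw [htr, htr]⟩
  rw [← Finset.sum_add_distrib, ← hTT]
  refine Finset.sum_congr rfl fun f _ => ?_
  rw [← Matrix.add_mul, ← Matrix.mul_add, h12, Matrix.mul_one]

/-! ### Private mechanisms: contraction and the Fuchs–Caves measurement -/

theorem IsState.trace_re {d : Type*} [Fintype d] {ρ : Matrix d d ℂ} (hρ : IsState ρ) :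
    ρ.trace.re = 1 := by rw [hρ.2, Complex.one_re]

theorem IsChannel.isState {a b : Type*} [Fintype a] [DecidableEq a] [Fintype b] [DecidableEq b]
    {Φ : Matrix a a ℂ →ₗ[ℂ] Matrix b b ℂ} (hΦ : IsChannel Φ) {ρ : Matrix a a ℂ}
    (hρ : IsState ρ) : IsState (Φ ρ) := by
  obtain ⟨K, hK⟩ := exists_kraus hΦ.1
  refine ⟨?_, (hΦ.2 ρ).trans hρ.2⟩
  rw [hK]
  exact posSemidef_sum _ fun i _ => hρ.1.mul_mul_conjTranspose_same _

theorem IsEffect.one_sub {d : Type*} [Fintype d] [DecidableEq d] {E : Matrix d d ℂ}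
    (hE : IsEffect E) : IsEffect (1 - E) := ⟨hE.2, by simpa using hE.1⟩

theorem re_trace_one_sub_mul {d : Type*} [Fintype d] [DecidableEq d] {ρ : Matrix d d ℂ}
    (hρ : IsState ρ) (E : Matrix d d ℂ) :
    ((1 - E) * ρ).trace.re = 1 - (E * ρ).trace.re := by
  rw [Matrix.sub_mul, Matrix.one_mul, Matrix.trace_sub, Complex.sub_re, hρ.trace_re]

theorem exists_isState_smul {d : Type*} [Fintype d] [DecidableEq d] {A : Matrix d d ℂ}
    (hA : A.PosSemidef) (h : 0 < A.trace.re) : ∃ ω, IsState ω ∧ A = A.trace.re • ω := by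
  have him : (A.trace.re : ℂ) = A.trace :=
    Complex.ext rfl (Complex.le_def.mp hA.trace_nonneg).2
  refine ⟨A.trace.re⁻¹ • A, ⟨hA.smul (inv_nonneg.mpr h.le), ?_⟩, ?_⟩
  · rw [Matrix.trace_smul, Complex.real_smul, Complex.ofReal_inv, him, inv_mul_cancel₀]
    intro h0
    simp [h0] at h
  · rw [smul_smul, mul_inv_cancel₀ h.ne', one_smul]

theorem eq_zero_of_trace_re_eq_zero {d : Type*} [Fintype d] [DecidableEq d] {A : Matrix d d ℂ}
    (hA : A.PosSemidef) (h : A.trace.re = 0) : A = 0 :=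
  hA.trace_eq_zero_iff.mp (Complex.ext h (Complex.le_def.mp hA.trace_nonneg).2.symm)

/-- Jordan decomposition of the difference of two states. -/
theorem exists_jordan_sub {d : Type*} [Fintype d] [DecidableEq d] {ρ σ : Matrix d d ℂ}
    (hρ : IsState ρ) (hσ : IsState σ) :
    ∃ A B E : Matrix d d ℂ, A.PosSemidef ∧ B.PosSemidef ∧ IsEffect E ∧ ρ - σ = A - B ∧
      E * (ρ - σ) = A ∧ A.trace.re = traceDist ρ σ ∧ B.trace.re = traceDist ρ σ := by
  obtain ⟨A, B, E, hA, hB, hE, hD, hED, htr⟩ := exists_jordan (hρ.1.1.sub hσ.1.1)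
  have h0 : A.trace.re - B.trace.re = 0 := by
    rw [← Complex.sub_re, ← Matrix.trace_sub, ← hD, Matrix.trace_sub, hρ.2, hσ.2]; simp
  refine ⟨A, B, E, hA, hB, hE, hD, hED, ?_, ?_⟩ <;> rw [traceDist] <;> linarith

/-- A private mechanism contracts the trace distance by `(e^ε - 1) / (e^ε + 1)`. -/
theorem IsQLDP.re_trace_mul_sub_le {a b : Type*} [Fintype a] [DecidableEq a] [Fintype b]
    [DecidableEq b] {ε : ℝ} {Φ : Matrix a a ℂ →ₗ[ℂ] Matrix b b ℂ} (hΦ : IsQLDP ε Φ)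
    {ρ σ : Matrix a a ℂ} (hρ : IsState ρ) (hσ : IsState σ) {E : Matrix b b ℂ}
    (hE : IsEffect E) :
    (E * Φ (ρ - σ)).trace.re * (Real.exp ε + 1) ≤ (Real.exp ε - 1) * traceDist ρ σ := by
  obtain ⟨A, B, -, hA, hB, -, hD, -, hAt, hBt⟩ := exists_jordan_sub hρ hσ
  have hT : 0 ≤ traceDist ρ σ := hAt ▸ (Complex.le_def.mp hA.trace_nonneg).1
  rcases hT.eq_or_lt with h0 | h0
  · rw [hD, eq_zero_of_trace_re_eq_zero hA (hAt.trans h0.symm),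
      eq_zero_of_trace_re_eq_zero hB (hBt.trans h0.symm), ← h0]
    simp
  obtain ⟨ω, hω, hAω⟩ := exists_isState_smul hA (hAt ▸ h0)
  obtain ⟨τ, hτ, hBτ⟩ := exists_isState_smul hB (hBt ▸ h0)
  -- Adding the privacy inequalities for `E` and, with the states exchanged, for `1 - E` gives the
  -- contraction factor.
  have h1 := hΦ.2 ω τ hω hτ E hE
  have h2 := hΦ.2 τ ω hτ hω (1 - E) hE.one_sub
  rw [re_trace_one_sub_mul (hΦ.1.isState hω), re_trace_one_sub_mul (hΦ.1.isState hτ)] at h2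
  have h3 : (E * Φ (ρ - σ)).trace.re =
      traceDist ρ σ * ((E * Φ ω).trace.re - (E * Φ τ).trace.re) := by
    rw [hD, hAω, hBτ, hAt, hBt, ← smul_sub, LinearMap.map_smul_of_tower, Matrix.mul_smul,
      Matrix.trace_smul, Complex.smul_re, map_sub, Matrix.mul_sub, Matrix.trace_sub,
      Complex.sub_re, smul_eq_mul]
  rw [h3]
  have h4 : ((E * Φ ω).trace.re - (E * Φ τ).trace.re) * (Real.exp ε + 1) ≤ Real.exp ε - 1 := by
    nlinarith
  nlinarith

/-- The last identity makes the outcome probabilities of `M σ M` equal to `l i ^ 2` times those of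
`σ`, so their geometric means sum to `Tr[M σ]`. -/
theorem exists_spectral_measure {d : Type*} [Fintype d] [DecidableEq d] {M : Matrix d d ℂ}
    (hM : M.PosSemidef) :
    ∃ (l : d → ℝ) (F : d → Matrix d d ℂ), (∀ i, 0 ≤ l i) ∧ (∀ i, (F i).PosSemidef) ∧
      ∑ i, F i = 1 ∧ M = ∑ i, l i • F i ∧ ∀ i, M * F i * M = (l i ^ 2) • F i := by
  set U : Matrix d d ℂ := hM.1.eigenvectorUnitary.1 with hU
  have hUU : Uᴴ * U = 1 := Unitary.coe_star_mul_self hM.1.eigenvectorUnitary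
  have hUU' : U * Uᴴ = 1 := Unitary.coe_mul_star_self hM.1.eigenvectorUnitary
  have hspec : M = U * diagonal (fun i => (hM.1.eigenvalues i : ℂ)) * Uᴴ := by
    conv_lhs => rw [hM.1.spectral_theorem]
    rw [Unitary.conjStarAlgAut_apply]
    rfl
  refine ⟨hM.1.eigenvalues, fun i => U * diagonal (Pi.single i 1) * Uᴴ, hM.eigenvalues_nonneg,
    fun i => ?_, ?_, ?_, fun i => ?_⟩
  · refine PosSemidef.mul_mul_conjTranspose_same (PosSemidef.diagonal ?_) U
    exact Pi.single_nonneg.mpr zero_le_one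
  · rw [← Matrix.sum_mul, ← Matrix.mul_sum]
    have : ∑ i, diagonal (Pi.single i (1 : ℂ)) = (1 : Matrix d d ℂ) := by
      ext j k
      simp [Matrix.sum_apply, Matrix.diagonal_apply, Matrix.one_apply, Pi.single_apply]
    rw [this, Matrix.mul_one, hUU']
  · conv_lhs => rw [hspec]
    have hsm : ∀ i, hM.1.eigenvalues i • (U * diagonal (Pi.single i 1) * Uᴴ) =
        U * (hM.1.eigenvalues i • diagonal (Pi.single i 1)) * Uᴴ := fun i => by
      rw [Matrix.mul_smul, Matrix.smul_mul]
    rw [Finset.sum_congr rfl fun i _ => hsm i, ← Matrix.sum_mul, ← Matrix.mul_sum]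
    refine congrArg (fun Z => U * Z * Uᴴ) ?_
    ext j k
    simp [Matrix.sum_apply, Matrix.diagonal_apply, Pi.single_apply]
  · have : M * (U * diagonal (Pi.single i 1) * Uᴴ) * M =
        U * (diagonal (fun i => (hM.1.eigenvalues i : ℂ)) * diagonal (Pi.single i 1) *
          diagonal (fun i => (hM.1.eigenvalues i : ℂ))) * Uᴴ := by
      conv_lhs => rw [hspec]
      simp only [Matrix.mul_assoc]
      rw [← Matrix.mul_assoc Uᴴ U, hUU, Matrix.one_mul, ← Matrix.mul_assoc Uᴴ U, hUU,
        Matrix.one_mul]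
    rw [this, ← Matrix.smul_mul, ← Matrix.mul_smul]
    refine congrArg (fun Z => U * Z * Uᴴ) ?_
    rw [diagonal_mul_diagonal, diagonal_mul_diagonal]
    ext j k
    by_cases hjk : j = k
    · subst hjk
      by_cases hji : j = i
      · subst hji; simp; ring
      · simp [hji]
    · simp [hjk]

/-- Purifications of the outputs of a private mechanism whose overlap is the Bhattacharyya
coefficient of the outcome distributions of a measurement. -/
theorem IsQLDP.exists_measurement {a b : Type*} [Fintype a] [DecidableEq a] [Fintype b]
    [DecidableEq b] {ε : ℝ} {Φ : Matrix a a ℂ →ₗ[ℂ] Matrix b b ℂ} (hΦ : IsQLDP ε Φ)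
    {ρ σ : Matrix a a ℂ} (hρ : IsState ρ) (hσ : IsState σ) :
    ∃ (X Y : Matrix b b ℂ) (P Q : b → ℝ), Φ ρ = X * Xᴴ ∧ Φ σ = Y * Yᴴ ∧
      (∀ i, 0 ≤ P i) ∧ (∀ i, 0 ≤ Q i) ∧ ∑ i, P i = 1 ∧ ∑ i, Q i = 1 ∧
      (∀ i, P i ≤ Real.exp ε * Q i) ∧ (∀ i, Q i ≤ Real.exp ε * P i) ∧
      ∑ i, √(P i * Q i) ≤ ‖(Xᴴ * Y).trace‖ ∧
      ((∑ i, |P i - Q i|) / 2) * (Real.exp ε + 1) ≤ (Real.exp ε - 1) * traceDist ρ σ := by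
  have hρ' := hΦ.1.isState hρ
  have hσ' := hΦ.1.isState hσ
  obtain ⟨M, hM, hMρ⟩ := exists_posSemidef_mul_mul_eq hρ'.1 hσ'.1 fun E hE h0 => by
    simpa [h0] using hΦ.2 ρ σ hρ hσ E hE
  obtain ⟨l, F, hl, hF, hF1, hMF, hMFM⟩ := exists_spectral_measure hM
  set Y := CFC.sqrt (Φ σ) with hY
  have hYh : Yᴴ = Y := (CFC.sqrt_nonneg (Φ σ)).posSemidef.1
  have hYY : Y * Y = Φ σ := CFC.sqrt_mul_sqrt_self _ hσ'.1.nonneg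
  have hES : ∀ S : Finset b, IsEffect (∑ i ∈ S, F i) := by
    intro S
    refine ⟨posSemidef_sum _ fun i _ => hF i, ?_⟩
    rw [← hF1, ← Finset.sum_add_sum_compl S F, add_sub_cancel_left]
    exact posSemidef_sum _ fun i _ => hF i
  have hFe : ∀ i, IsEffect (F i) := fun i => by simpa using hES {i}
  have hsum : ∀ {τ : Matrix b b ℂ}, IsState τ → ∑ i, (F i * τ).trace.re = 1 := by
    intro τ hτ
    rw [← Complex.re_sum, ← Matrix.trace_sum, ← Matrix.sum_mul, hF1, Matrix.one_mul, hτ.trace_re]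
  have hQ0 : ∀ i, 0 ≤ (F i * Φ σ).trace.re := fun i => re_trace_mul_nonneg (hF i) hσ'.1
  have hPQ : ∀ i, (F i * Φ ρ).trace.re = l i ^ 2 * (F i * Φ σ).trace.re := by
    intro i
    rw [← hMρ, ← Matrix.mul_assoc, Matrix.trace_mul_comm, ← Matrix.mul_assoc, ← Matrix.mul_assoc,
      hMFM, Matrix.smul_mul, Matrix.trace_smul, Complex.smul_re, smul_eq_mul]
  -- With `Y = √(Φ σ)` and `X = M Y`, both factorizations hold and `Tr X†Y = Tr[M Φ(σ)]`.
  refine ⟨M * Y, Y, fun i => (F i * Φ ρ).trace.re, fun i => (F i * Φ σ).trace.re, ?_, ?_,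
    fun i => re_trace_mul_nonneg (hF i) hρ'.1, hQ0, hsum hρ', hsum hσ',
    fun i => hΦ.2 ρ σ hρ hσ _ (hFe i), fun i => hΦ.2 σ ρ hσ hρ _ (hFe i), ?_, ?_⟩
  · rw [conjTranspose_mul, hYh, hM.1.eq, ← hMρ, ← hYY]; simp only [Matrix.mul_assoc]
  · rw [hYh, hYY]
  · refine le_trans (le_of_eq ?_) (Complex.re_le_norm _)
    rw [conjTranspose_mul, hYh, hM.1.eq, Matrix.trace_mul_comm, ← Matrix.mul_assoc, hYY,
      Matrix.trace_mul_comm]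
    conv_rhs => rw [hMF]
    rw [Matrix.sum_mul, Matrix.trace_sum, Complex.re_sum]
    refine Finset.sum_congr rfl fun i _ => ?_
    simp only
    rw [hPQ, Matrix.smul_mul, Matrix.trace_smul, Complex.smul_re, smul_eq_mul, mul_assoc, ← sq,
      ← mul_pow, Real.sqrt_sq (mul_nonneg (hl i) (hQ0 i))]
  · set D : b → ℝ := fun i => (F i * Φ ρ).trace.re - (F i * Φ σ).trace.re with hD
    have hD0 : ∑ i, D i = 0 := by
      rw [hD, Finset.sum_sub_distrib, hsum hρ', hsum hσ', sub_self]
    -- Since `D` sums to zero, half its `ℓ¹` norm is its mass where it is nonnegative; grouping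
    -- those outcomes gives a single effect.
    have habs : (∑ i, |D i|) / 2 = ∑ i ∈ Finset.univ.filter (fun i => 0 ≤ D i), D i := by
      have hadd : ∑ i, |D i| = ∑ i, (|D i| + D i) := by
        rw [Finset.sum_add_distrib, hD0, add_zero]
      rw [Finset.sum_filter, hadd, Finset.sum_div]
      refine Finset.sum_congr rfl fun i _ => ?_
      split_ifs with h
      · rw [abs_of_nonneg h]; ring
      · rw [abs_of_neg (not_le.mp h)]; ring
    rw [habs]
    convert hΦ.re_trace_mul_sub_le hρ hσ (hES (Finset.univ.filter fun i => 0 ≤ D i)) using 2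
    rw [map_sub, Matrix.sum_mul, Matrix.trace_sum, Complex.re_sum]
    refine Finset.sum_congr rfl fun i _ => ?_
    rw [Matrix.mul_sub, Matrix.trace_sub, Complex.sub_re]

/-! ### Measurement channels and the Bhattacharyya upper bound -/

theorem ampliation_posSemidef_of_kraus {a b ι : Type*} [Fintype a] [Fintype b] [Fintype ι]
    {Φ : Matrix a a ℂ →ₗ[ℂ] Matrix b b ℂ} {K : ι → Matrix b a ℂ}
    (hK : ∀ X, Φ X = ∑ g, K g * X * (K g)ᴴ) (k : ℕ) {X : Matrix (Fin k × a) (Fin k × a) ℂ}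
    (hX : X.PosSemidef) : (ampliation k Φ X).PosSemidef := by
  have : ampliation k Φ X = ∑ g, kroneckerMap (· * ·) (1 : Matrix (Fin k) (Fin k) ℂ) (K g) * X *
      (kroneckerMap (· * ·) (1 : Matrix (Fin k) (Fin k) ℂ) (K g))ᴴ := by
    ext ⟨i, x⟩ ⟨j, y⟩
    simp only [ampliation, hK, Matrix.of_apply, Matrix.sum_apply, Matrix.mul_apply,
      conjTranspose_apply, kroneckerMap_apply, Fintype.sum_prod_type, Matrix.one_apply]
    refine Finset.sum_congr rfl fun g _ => ?_
    conv_rhs => rw [Finset.sum_comm]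
    simp [apply_ite (starRingEnd ℂ)]
  rw [this]
  exact posSemidef_sum _ fun g _ => hX.mul_mul_conjTranspose_same _

/-- The quantum-to-classical map of a family of measurement operators. -/
def measureMap {a ι : Type*} [Fintype a] [Fintype ι] [DecidableEq ι] (G : ι → Matrix a a ℂ) :
    Matrix a a ℂ →ₗ[ℂ] Matrix ι ι ℂ where
  toFun X := diagonal fun x => (G x * X).trace
  map_add' X Y := by
    simp only [Matrix.mul_add, Matrix.trace_add, ← Matrix.diagonal_add]
  map_smul' c X := by
    simp only [Matrix.mul_smul, Matrix.trace_smul, RingHom.id_apply, ← Matrix.diagonal_smul]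
    rfl

theorem measureMap_apply {a ι : Type*} [Fintype a] [Fintype ι] [DecidableEq ι]
    (G : ι → Matrix a a ℂ) (X : Matrix a a ℂ) :
    measureMap G X = diagonal fun x => (G x * X).trace := rfl

theorem measureMap_isChannel {a ι : Type*} [Fintype a] [DecidableEq a] [Fintype ι]
    [DecidableEq ι] {G : ι → Matrix a a ℂ} (hG : ∀ x, (G x).PosSemidef) (hG1 : ∑ x, G x = 1) :
    IsChannel (measureMap G) := by
  choose C hC using fun x => CStarAlgebra.nonneg_iff_eq_star_mul_self.mp (hG x).nonneg
  refine ⟨fun k X hX => ampliation_posSemidef_of_kraus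
    (K := fun g : ι × a => Matrix.of fun y s => if y = g.1 then C g.1 g.2 s else 0) ?_ k hX, ?_⟩
  · intro X
    ext y z
    have htr : ∀ x, (G x * X).trace = (C x * X * (C x)ᴴ).trace := fun x => by
      rw [hC, star_eq_conjTranspose, Matrix.mul_assoc, Matrix.trace_mul_comm]
    simp only [measureMap_apply, htr]
    simp only [Matrix.diagonal_apply, Matrix.sum_apply, Fintype.sum_prod_type, Matrix.trace,
      Matrix.diag_apply, Matrix.mul_apply, Matrix.of_apply, conjTranspose_apply]
    by_cases hyz : y = z
    · subst hyz
      simp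
    · simp [hyz, Ne.symm hyz]
  · intro X
    rw [measureMap_apply, Matrix.trace_diagonal, ← Matrix.trace_sum, ← Matrix.sum_mul, hG1,
      Matrix.one_mul]

theorem trace_mul_eq_ofReal {d : Type*} [Fintype d] {A B : Matrix d d ℂ}
    (hA : A.IsHermitian) (hB : B.IsHermitian) :
    (A * B).trace = ((A * B).trace.re : ℂ) := by
  symm
  rw [← Complex.conj_eq_iff_re, ← Complex.star_def, ← Matrix.trace_conjTranspose,
    conjTranspose_mul, hA.eq, hB.eq, Matrix.trace_mul_comm]

theorem tensorPow_diagonal {ι : Type*} [DecidableEq ι] (n : ℕ) (z : ι → ℂ) :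
    tensorPow n (diagonal z) = diagonal fun x : Fin n → ι => ∏ k, z (x k) := by
  ext i j
  simp only [tensorPow, Matrix.of_apply, Matrix.diagonal_apply, Finset.prod_ite_zero,
    Finset.mem_univ, true_imp_iff, funext_iff]

/-- The Bhattacharyya bound for `n` samples from commuting states. -/
theorem errorProb_diagonal_le {ι : Type*} [Fintype ι] [DecidableEq ι] {P Q : ι → ℝ}
    (hP : ∀ x, 0 ≤ P x) (hQ : ∀ x, 0 ≤ Q x) {p q : ℝ} (hp : 0 ≤ p) (hq : 0 ≤ q) (n : ℕ) :
    errorProb (tensorPow n (diagonal fun x => (P x : ℂ)))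
        (tensorPow n (diagonal fun x => (Q x : ℂ))) p q ≤
      √(p * q) * (∑ x, √(P x * Q x)) ^ n := by
  have hpsd : ∀ {R : ι → ℝ}, (∀ x, 0 ≤ R x) →
      (tensorPow n (diagonal fun x => (R x : ℂ))).PosSemidef := fun hR =>
    tensorPow_posSemidef (PosSemidef.diagonal fun x => Complex.zero_le_real.mpr (hR x)) n
  -- Likelihood-ratio test: each outcome costs the smaller of the two weights, which is at most
  -- their geometric mean.
  set c : (Fin n → ι) → Prop := fun x => q * ∏ k, Q (x k) ≤ p * ∏ k, P (x k) with hc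
  classical
  refine (csInf_le (errorProb_bddBelow (hpsd hP) (hpsd hQ) hp hq)
    ⟨diagonal fun x => if c x then 1 else 0, diagonal fun x => if c x then 0 else 1,
      PosSemidef.diagonal fun x => ?_, PosSemidef.diagonal fun x => ?_, ?_, rfl⟩).trans ?_
  · simp only [Pi.zero_apply]; split_ifs <;> simp
  · simp only [Pi.zero_apply]; split_ifs <;> simp
  · rw [diagonal_add, ← diagonal_one]
    congr 1
    ext x
    split_ifs <;> simp
  · rw [tensorPow_diagonal, tensorPow_diagonal, diagonal_mul_diagonal, diagonal_mul_diagonal,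
      trace_diagonal, trace_diagonal, Complex.re_sum, Complex.re_sum, Finset.mul_sum,
      Finset.mul_sum, ← Finset.sum_add_distrib, ← Fin.prod_const, Fintype.prod_sum,
      Finset.mul_sum]
    refine Finset.sum_le_sum fun x _ => ?_
    have hPx : 0 ≤ ∏ k, P (x k) := Finset.prod_nonneg fun k _ => hP _
    have hQx : 0 ≤ ∏ k, Q (x k) := Finset.prod_nonneg fun k _ => hQ _
    have e : √(p * q) * ∏ k, √(P (x k) * Q (x k)) =
        √((p * ∏ k, P (x k)) * (q * ∏ k, Q (x k))) := by
      rw [← Real.sqrt_prod _ fun k _ => mul_nonneg (hP _) (hQ _),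
        ← Real.sqrt_mul (mul_nonneg hp hq), Finset.prod_mul_distrib]
      congr 1
      ring
    rw [e]
    refine Real.le_sqrt_of_sq_le ?_
    rw [← Complex.ofReal_prod, ← Complex.ofReal_prod]
    have hu := mul_nonneg hp hPx
    have hv := mul_nonneg hq hQx
    split_ifs with h
    · simp only [zero_mul, one_mul, Complex.zero_re, Complex.ofReal_re, mul_zero, zero_add]
      rw [sq]
      exact mul_le_mul_of_nonneg_right h hv
    · simp only [zero_mul, one_mul, Complex.zero_re, Complex.ofReal_re, mul_zero, add_zero]
      rw [sq]
      exact mul_le_mul_of_nonneg_left (not_le.mp h).le hu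

/-- By AM–GM the squared coefficient is at most `1 - (P 0 - Q 0)²`, and `1 - t ≤ e^{-t}`. -/
theorem sum_sqrt_le_exp {P Q : Fin 2 → ℝ} (hP : ∀ x, 0 ≤ P x) (hQ : ∀ x, 0 ≤ Q x)
    (hP1 : ∑ x, P x = 1) (hQ1 : ∑ x, Q x = 1) :
    ∑ x, √(P x * Q x) ≤ Real.exp (-(P 0 - Q 0) ^ 2 / 2) := by
  rw [Fin.sum_univ_two] at *
  have hP2 : P 1 = 1 - P 0 := by linarith
  have hQ2 : Q 1 = 1 - Q 0 := by linarith
  rw [Real.exp_half]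
  refine Real.le_sqrt_of_sq_le (le_trans ?_ (Real.add_one_le_exp _))
  have s1 := Real.sq_sqrt (hP 0)
  have s2 := Real.sq_sqrt (hP 1)
  have s3 := Real.sq_sqrt (hQ 0)
  have s4 := Real.sq_sqrt (hQ 1)
  rw [Real.sqrt_mul (hP 0), Real.sqrt_mul (hP 1)]
  set x := √(P 0)
  set y := √(P 1)
  set z := √(Q 0)
  set w := √(Q 1)
  have e1 : (x * z + y * w) ^ 2 = P 0 * Q 0 + P 1 * Q 1 + 2 * (x * y) * (z * w) := by
    rw [← s1, ← s2, ← s3, ← s4]; ring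
  have e2 : 2 * (x * y) * (z * w) ≤ P 0 * P 1 + Q 0 * Q 1 := by
    rw [← s1, ← s2, ← s3, ← s4]; nlinarith [sq_nonneg (x * y - z * w)]
  rw [e1]
  rw [hP2, hQ2] at e2 ⊢
  nlinarith

/-! ### Randomized response and the upper bound -/

/-- The noisy measurement that applies randomized response with bias `η` to the test `E`. -/
noncomputable def randomizedResponse {a : Type*} [DecidableEq a] (η : ℝ) (E : Matrix a a ℂ) :
    Fin 2 → Matrix a a ℂ :=
  ![η • 1 + (1 - 2 * η) • E, η • 1 + (1 - 2 * η) • (1 - E)]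

theorem randomizedResponse_posSemidef {a : Type*} [Fintype a] [DecidableEq a] {η : ℝ}
    (h0 : 0 ≤ η) (h1 : 0 ≤ 1 - 2 * η) {E : Matrix a a ℂ} (hE : IsEffect E) (x : Fin 2) :
    (randomizedResponse η E x).PosSemidef := by
  fin_cases x
  · exact (PosSemidef.one.smul h0).add (hE.1.smul h1)
  · exact (PosSemidef.one.smul h0).add (hE.2.smul h1)

theorem sum_randomizedResponse {a : Type*} [DecidableEq a] (η : ℝ) (E : Matrix a a ℂ) :
    ∑ x, randomizedResponse η E x = 1 := by
  rw [Fin.sum_univ_two]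
  simp only [randomizedResponse, Matrix.cons_val_zero, Matrix.cons_val_one]
  module

theorem re_trace_smul_add_mul {a : Type*} [Fintype a] [DecidableEq a] {ρ : Matrix a a ℂ}
    (hρ : IsState ρ) (η c : ℝ) (E : Matrix a a ℂ) :
    ((η • (1 : Matrix a a ℂ) + c • E) * ρ).trace.re = η + c * (E * ρ).trace.re := by
  rw [Matrix.add_mul, Matrix.smul_mul, Matrix.smul_mul, Matrix.one_mul, Matrix.trace_add,
    Matrix.trace_smul, Matrix.trace_smul, Complex.add_re, Complex.smul_re, Complex.smul_re,
    hρ.trace_re, smul_eq_mul, smul_eq_mul, mul_one]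

theorem re_trace_randomizedResponse_mem {a : Type*} [Fintype a] [DecidableEq a] {η : ℝ}
    (h1 : 0 ≤ 1 - 2 * η) {E : Matrix a a ℂ} (hE : IsEffect E) {ρ : Matrix a a ℂ}
    (hρ : IsState ρ) (x : Fin 2) :
    (randomizedResponse η E x * ρ).trace.re ∈ Set.Icc η (1 - η) := by
  have key : ∀ {F : Matrix a a ℂ}, IsEffect F →
      ((η • (1 : Matrix a a ℂ) + (1 - 2 * η) • F) * ρ).trace.re ∈ Set.Icc η (1 - η) := by
    intro F hF
    rw [re_trace_smul_add_mul hρ]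
    have u := re_trace_mul_nonneg hF.1 hρ.1
    have v := re_trace_mul_nonneg hF.2 hρ.1
    rw [re_trace_one_sub_mul hρ] at v
    exact ⟨by nlinarith, by nlinarith⟩
  fin_cases x
  · exact key hE
  · exact key hE.one_sub

theorem measureMap_eq_ofReal {a ι : Type*} [Fintype a] [Fintype ι] [DecidableEq ι]
    {G : ι → Matrix a a ℂ} (hG : ∀ x, (G x).PosSemidef) {ρ : Matrix a a ℂ}
    (hρ : ρ.PosSemidef) :
    measureMap G ρ = diagonal fun x => ((G x * ρ).trace.re : ℂ) := by
  rw [measureMap_apply]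
  congr 1
  ext x
  exact trace_mul_eq_ofReal (hG x).1 hρ.1

/-- The output is diagonal, so a test sees it only through its own nonnegative diagonal; privacy
need only be checked outcome by outcome. -/
theorem measureMap_isQLDP {a ι : Type*} [Fintype a] [DecidableEq a] [Fintype ι]
    [DecidableEq ι] {G : ι → Matrix a a ℂ} (hG : ∀ x, (G x).PosSemidef) (hG1 : ∑ x, G x = 1)
    {ε : ℝ} (h : ∀ ρ σ : Matrix a a ℂ, IsState ρ → IsState σ → ∀ x,
      (G x * ρ).trace.re ≤ Real.exp ε * (G x * σ).trace.re) :
    IsQLDP ε (measureMap G) := by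
  refine ⟨measureMap_isChannel hG hG1, fun ρ σ hρ hσ M hM => ?_⟩
  have key : ∀ {τ : Matrix a a ℂ}, IsState τ →
      (M * measureMap G τ).trace.re = ∑ x, (M x x).re * (G x * τ).trace.re := by
    intro τ hτ
    rw [measureMap_eq_ofReal hG hτ.1, Matrix.trace, Complex.re_sum]
    refine Finset.sum_congr rfl fun x _ => ?_
    rw [Matrix.diag_apply, Matrix.mul_diagonal, Complex.re_mul_ofReal]
  rw [key hρ, key hσ, Finset.mul_sum]
  refine Finset.sum_le_sum fun x _ => ?_
  rw [mul_left_comm]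
  exact mul_le_mul_of_nonneg_left (h ρ σ hρ hσ x) (Complex.le_def.mp hM.1.diag_nonneg).1

theorem privateSampleComplexity_le {d : Type*} [Fintype d] [DecidableEq d]
    {ρ σ : Matrix d d ℂ} (hρ : IsState ρ) (hσ : IsState σ) {p q α ε : ℝ} (hp : 0 ≤ p)
    (hq : 0 ≤ q) (hε : 0 < ε) {n : ℕ}
    (hn : √(p * q) * Real.exp (-(n * ((Real.exp ε - 1) / (Real.exp ε + 1) *
      traceDist ρ σ) ^ 2 / 2)) ≤ α) :
    privateSampleComplexity ε ρ σ α p q ≤ n := by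
  obtain ⟨A, -, E, -, -, hE, -, hED, hAt, -⟩ := exists_jordan_sub hρ hσ
  have hE1 : 1 < Real.exp ε := Real.one_lt_exp_iff.mpr hε
  -- Outcome probabilities lie in `[η, 1 - η]`; this `η` makes `(1 - η)/η` equal to `e^ε`.
  set η : ℝ := 1 / (Real.exp ε + 1) with hη
  have hη0 : 0 ≤ η := by positivity
  have hη2 : 1 - 2 * η = (Real.exp ε - 1) / (Real.exp ε + 1) := by rw [hη]; field_simp; ring
  have hη1 : 0 ≤ 1 - 2 * η := by
    rw [hη2]; exact div_nonneg (sub_nonneg.mpr hE1.le) (by positivity)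
  have hηε : 1 - η = Real.exp ε * η := by rw [hη]; field_simp; ring
  set G := randomizedResponse η E with hGdef
  have hG := randomizedResponse_posSemidef hη0 hη1 hE
  have hG1 := sum_randomizedResponse η E
  have hmem := fun {τ : Matrix d d ℂ} (hτ : IsState τ) (x : Fin 2) =>
    re_trace_randomizedResponse_mem hη1 hE hτ x
  have hL : IsQLDP ε (measureMap G) := measureMap_isQLDP hG hG1 fun τ ω hτ hω x => by
    refine (hmem hτ x).2.trans ?_
    rw [hηε]
    exact mul_le_mul_of_nonneg_left (hmem hω x).1 (Real.exp_pos _).le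
  refine (iInf_le_of_le 2 (iInf₂_le (measureMap G) hL)).trans (iInf₂_le n ?_)
  have hnn : ∀ {τ : Matrix d d ℂ}, IsState τ → ∀ x, 0 ≤ (G x * τ).trace.re :=
    fun hτ x => re_trace_mul_nonneg (hG x) hτ.1
  have hsum : ∀ {τ : Matrix d d ℂ}, IsState τ → ∑ x, (G x * τ).trace.re = 1 := by
    intro τ hτ
    rw [← Complex.re_sum, ← Matrix.trace_sum, ← Matrix.sum_mul, hG1, Matrix.one_mul, hτ.trace_re]
  have hdiff : (G 0 * ρ).trace.re - (G 0 * σ).trace.re =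
      (Real.exp ε - 1) / (Real.exp ε + 1) * traceDist ρ σ := by
    have : G 0 = η • 1 + (1 - 2 * η) • E := rfl
    rw [this, re_trace_smul_add_mul hρ, re_trace_smul_add_mul hσ, ← hη2, ← hAt, ← hED,
      Matrix.mul_sub, Matrix.trace_sub, Complex.sub_re]
    ring
  rw [measureMap_eq_ofReal hG hρ.1, measureMap_eq_ofReal hG hσ.1]
  refine (errorProb_diagonal_le (hnn hρ) (hnn hσ) hp hq n).trans (le_trans ?_ hn)
  refine mul_le_mul_of_nonneg_left ?_ (Real.sqrt_nonneg _)
  refine (pow_le_pow_left₀ (Finset.sum_nonneg fun _ _ => Real.sqrt_nonneg _)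
    (sum_sqrt_le_exp (hnn hρ) (hnn hσ) (hsum hρ) (hsum hσ)) n).trans (le_of_eq ?_)
  rw [hdiff, ← Real.exp_nat_mul]
  congr 1
  ring

/-! ### Assembling the bounds -/

/-- The lower bound on the number of copies for a fixed private mechanism. -/
theorem IsQLDP.lowerConst_le {a b : Type*} [Fintype a] [DecidableEq a] [Fintype b]
    [DecidableEq b] {ε : ℝ} (hε : 0 < ε) {Φ : Matrix a a ℂ →ₗ[ℂ] Matrix b b ℂ}
    (hΦ : IsQLDP ε Φ) {ρ σ : Matrix a a ℂ} (hρ : IsState ρ) (hσ : IsState σ) {p q α : ℝ}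
    (hp : 0 < p) (hq : 0 < q) (hpq : p + q = 1) (hα : 0 < α) (hαpq : α < p * q) {n : ℕ}
    (hn : errorProb (tensorPow n (Φ ρ)) (tensorPow n (Φ σ)) p q ≤ α) :
    lowerConst ε p q α ≤ n * traceDist ρ σ := by
  have hE1 : 1 < Real.exp ε := Real.one_lt_exp_iff.mpr hε
  have hα2 : α ≤ 1 / 2 := by nlinarith [sq_nonneg (p - q)]
  obtain ⟨X, Y, P, Q, hX, hY, hP, hQ, hP1, hQ1, hPQ, hQP, hF, hV⟩ :=
    hΦ.exists_measurement hρ hσ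
  rw [hX, hY] at hn
  have hB := mul_norm_trace_pow_le (hX ▸ (hΦ.1.isState hρ).2) (hY ▸ (hΦ.1.isState hσ).2)
    hp.le hq.le hpq hα.le hα2 hn
  set B := ∑ i, √(P i * Q i) with hBdef
  set V := (∑ i, |P i - Q i|) / 2 with hVdef
  have hB0 : 0 ≤ B := Finset.sum_nonneg fun _ _ => Real.sqrt_nonneg _
  replace hB : p * q * (B ^ n) ^ 2 ≤ α * (1 - α) := le_trans (by gcongr) hB
  have hpq0 : 0 < p * q := mul_pos hp hq
  refine max_le ?_ ?_
  · have h1 := exp_neg_le_sum_sqrt hε hP hQ hP1 hQ1 hPQ hQP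
    rw [← hVdef, ← hBdef] at h1
    have h2 : p * q * Real.exp (-(n * (ε * V))) ≤ α := by
      calc p * q * Real.exp (-(n * (ε * V))) = p * q * (Real.exp (-(ε * V / 2)) ^ n) ^ 2 := by
            rw [← pow_mul, ← Real.exp_nat_mul]; congr 2; push_cast; ring
        _ ≤ p * q * (B ^ n) ^ 2 := by gcongr
        _ ≤ α * (1 - α) := hB
        _ ≤ α := by nlinarith
    have h3 : Real.log (p * q / α) ≤ n * (ε * V) := by
      rw [Real.log_le_iff_le_exp (by positivity), div_le_iff₀ hα]
      rw [Real.exp_neg, ← div_eq_mul_inv, div_le_iff₀ (Real.exp_pos _)] at h2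
      linarith
    rw [div_le_iff₀ (mul_pos hε (sub_pos.mpr hE1))]
    calc Real.log (p * q / α) * (Real.exp ε + 1) ≤ n * (ε * V) * (Real.exp ε + 1) := by gcongr
      _ = n * ε * (V * (Real.exp ε + 1)) := by ring
      _ ≤ n * ε * ((Real.exp ε - 1) * traceDist ρ σ) := by gcongr
      _ = _ := by ring
  · have h1 := one_sub_sum_sqrt_le hP hQ hP1 hQ1 hPQ hQP
    rw [← hVdef, ← hBdef] at h1
    set s := Real.exp (ε / 2) with hs
    have hs1 : 1 < s := Real.one_lt_exp_iff.mpr (half_pos hε)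
    have hss : Real.exp ε = s ^ 2 := by rw [hs, ← Real.exp_nat_mul]; congr 1; push_cast; ring
    rw [hss] at hV ⊢
    -- Bernoulli's inequality with exponent `2n`.
    have h2 : 1 - 2 * n * (1 - B) ≤ (B ^ n) ^ 2 := by
      have := one_add_mul_le_pow (a := B - 1) (by linarith) (n * 2)
      rw [add_sub_cancel, pow_mul] at this
      push_cast at this
      linarith
    have h3 : p * q - α * (1 - α) ≤ 2 * p * q * (n * (1 - B)) := by nlinarith
    have h4 : (1 - B) * (s ^ 2 + 1) ≤ traceDist ρ σ * (s - 1) ^ 2 := by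
      have h5 : (1 - B) * (s + 1) * (s ^ 2 + 1) ≤ traceDist ρ σ * (s - 1) ^ 2 * (s + 1) := by
        calc (1 - B) * (s + 1) * (s ^ 2 + 1) ≤ V * (s - 1) * (s ^ 2 + 1) := by gcongr
          _ = V * (s ^ 2 + 1) * (s - 1) := by ring
          _ ≤ (s ^ 2 - 1) * traceDist ρ σ * (s - 1) :=
            mul_le_mul_of_nonneg_right hV (sub_pos.mpr hs1).le
          _ = _ := by ring
      refine le_of_mul_le_mul_right (a := s + 1) ?_ (by positivity)
      linarith
    have hs2 : 0 < (s - 1) ^ 2 := pow_pos (sub_pos.mpr hs1) 2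
    rw [div_le_iff₀ (by positivity)]
    calc (p * q - α * (1 - α)) * (s ^ 2 + 1) ≤ 2 * p * q * (n * (1 - B)) * (s ^ 2 + 1) := by
          gcongr
      _ = 2 * p * q * n * ((1 - B) * (s ^ 2 + 1)) := by ring
      _ ≤ 2 * p * q * n * (traceDist ρ σ * (s - 1) ^ 2) := by gcongr
      _ = _ := by ring

theorem traceDist_nonneg {d : Type*} [Fintype d] [DecidableEq d] {ρ σ : Matrix d d ℂ}
    (hρ : IsState ρ) (hσ : IsState σ) : 0 ≤ traceDist ρ σ := by
  obtain ⟨A, -, -, hA, -, -, -, -, hAt, -⟩ := exists_jordan_sub hρ hσ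
  exact hAt ▸ (Complex.le_def.mp hA.trace_nonneg).1

end QLDP

/-- The bounds are read in `[0, ∞]`: for `ρ = σ` they say that the private sample complexity is
`⊤`, as a positive number divided by `0` is `∞` there. All real numbers under
`ENNReal.ofReal` are nonnegative, and `⌈·⌉ₑ` is the ceiling `[0, ∞] → ℕ ∪ {∞}`. -/
theorem mainTheorem4 {d : Type*} [Fintype d] [DecidableEq d] (ρ σ : Matrix d d ℂ)
    (hρ : QLDP.IsState ρ) (hσ : QLDP.IsState σ)
    (p q α ε : ℝ) (hp : 0 < p) (hp1 : p < 1) (hq : q = 1 - p)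
    (hα : 0 < α) (hαpq : α < p * q) (hε : 0 < ε) :
    max ((QLDP.sampleComplexity ρ σ α p q : ℕ∞) : ℝ≥0∞)
        (ENNReal.ofReal (QLDP.lowerConst ε p q α) / ENNReal.ofReal (QLDP.traceDist ρ σ))
      ≤ ((QLDP.privateSampleComplexity ε ρ σ α p q : ℕ∞) : ℝ≥0∞) ∧
    QLDP.privateSampleComplexity ε ρ σ α p q ≤
      ⌈ENNReal.ofReal (2 * Real.log (√(p * q) / α)) *
        (ENNReal.ofReal ((Real.exp ε + 1) / (Real.exp ε - 1)) /
          ENNReal.ofReal (QLDP.traceDist ρ σ)) ^ 2⌉ₑ := by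
  have hq0 : 0 < q := by linarith
  have hpq : p + q = 1 := by linarith
  have hpq0 : 0 < p * q := mul_pos hp hq0
  have hE1 : 1 < Real.exp ε := Real.one_lt_exp_iff.mpr hε
  -- Passing to the ceiling turns the second bound into an inequality in `ℕ∞`, where the infima
  -- unfold.
  refine ⟨max_le (ENat.toENNReal_le.mpr ?_) (ENat.ceil_le.mp ?_), ?_⟩
  · refine le_iInf fun m => le_iInf₂ fun Φ hΦ => le_iInf₂ fun n hn => iInf₂_le n ?_
    exact (QLDP.errorProb_le_of_isChannel hΦ.1 hρ.1 hσ.1 hp.le hq0.le n).trans hn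
  · refine le_iInf fun m => le_iInf₂ fun Φ hΦ => le_iInf₂ fun n hn => ENat.ceil_le.mpr ?_
    -- This also covers `T = 0`, so `ρ = σ` needs no separate case here.
    refine ENNReal.div_le_of_le_mul ?_
    rw [ENat.toENNReal_coe, ← ENNReal.ofReal_natCast, ← ENNReal.ofReal_mul (Nat.cast_nonneg n)]
    exact ENNReal.ofReal_le_ofReal
      (hΦ.lowerConst_le hε hρ hσ hp hq0 hpq hα hαpq hn)
  · have hratio : 1 < √(p * q) / α := by
      rw [one_lt_div hα]
      refine hαpq.trans_le (Real.le_sqrt_of_sq_le ?_)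
      exact pow_le_of_le_one hpq0.le (mul_le_one₀ hp1.le hq0.le (by linarith)) two_ne_zero
    have hlog : 0 < Real.log (√(p * q) / α) := Real.log_pos hratio
    have hE : 0 < (Real.exp ε + 1) / (Real.exp ε - 1) :=
      div_pos (by positivity) (sub_pos.mpr hE1)
    rcases (QLDP.traceDist_nonneg hρ hσ).eq_or_lt with hT | hT
    · rw [← hT, ENNReal.ofReal_zero, ENNReal.div_zero (ENNReal.ofReal_pos.mpr hE).ne',
        ENNReal.top_pow two_ne_zero, ENNReal.mul_top (ENNReal.ofReal_pos.mpr (by positivity)).ne',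
        ENat.ceil_top]
      exact le_top
    · set T := QLDP.traceDist ρ σ with hTdef
      rw [← ENNReal.ofReal_div_of_pos hT, ← ENNReal.ofReal_pow (by positivity),
        ← ENNReal.ofReal_mul (by positivity), ENNReal.ofReal, ENat.ceil_coe]
      set r := 2 * Real.log (√(p * q) / α) *
        ((Real.exp ε + 1) / (Real.exp ε - 1) / T) ^ 2 with hr
      refine QLDP.privateSampleComplexity_le hρ hσ hp.le hq0.le hε ?_
      have hrn : r ≤ (⌈r.toNNReal⌉₊ : ℝ) :=
        (Real.le_coe_toNNReal r).trans (by exact_mod_cast Nat.le_ceil r.toNNReal)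
      rw [← hTdef]
      set δ := (Real.exp ε - 1) / (Real.exp ε + 1) * T with hδ
      have hδ0 : 0 < δ := mul_pos (div_pos (sub_pos.mpr hE1) (by positivity)) hT
      have hrδ : r * δ ^ 2 / 2 = Real.log (√(p * q) / α) := by
        have := (sub_pos.mpr hE1).ne'
        rw [hr, hδ]
        field_simp
      have hle : Real.log (√(p * q) / α) ≤ (⌈r.toNNReal⌉₊ : ℝ) * δ ^ 2 / 2 := by
        rw [← hrδ]; gcongr
      rw [Real.log_le_iff_le_exp (by positivity), div_le_iff₀ hα] at hle
      rw [Real.exp_neg, ← div_eq_mul_inv, div_le_iff₀ (Real.exp_pos _)]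
      linarith
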